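/- Let $X$ and $Y$ be Polish spaces. Let $F$ be a smooth Borel equivalence relation on $X$; that is, $F$ is a Borel subset of $X \times X$ and there are a Polish space $Z$ and a Borel function $S \colon X \to Z$ such that $x_1 \mathrel{F} x_2 \iff S(x_1) = S(x_2)$ for all $x_1, x_2 \in X$. Let $P \subseteq X \times Y$ be a Borel set all of whose sections $P_x = \{y \in Y : (x,y) \in P\}$, $x \in X$, are countable. Suppose that \[\bigcap_{x \in C} P_x \neq \emptyset\] for every $F$-class $C$. Then $P$ admits a Borel $F$-invariant uniformization; that is, there is a Borel function $f \colon X \to Y$ such that $(x, f(x)) \in P$ for every $x \in X$, and $x_1 \mathrel{F} x_2 \implies f(x_1) = f(x_2)$ for all $x_1, x_2 \in X$. -/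

import Mathlib

universe u v w

/-- The `x`-section `P_x = {y | (x, y) ∈ P}` of a relation `P ⊆ X × Y`. -/
def xSection {X Y : Type*} (P : Set (X × Y)) (x : X) : Set Y :=
  {y | (x, y) ∈ P}

/-- An equivalence relation `F` on a space `X` is Borel if it is a Borel subset of `X × X`. -/
def IsBorelEquivRel {X : Type*} [MeasurableSpace X] (F : Setoid X) : Prop :=
  MeasurableSet {p : X × X | F p.1 p.2}

/-- A Borel equivalence relation `F` on `X` is smooth if there are a Polish space `Z` and a Borel
function `S : X → Z` such that `x₁ F x₂ ↔ S x₁ = S x₂`. (The universe of `Z` is arbitrary.) -/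
def IsSmoothBorelEquivRel {X : Type u} [MeasurableSpace X] (F : Setoid X) : Prop :=
  IsBorelEquivRel F ∧
    ∃ (Z : Type w) (_ : TopologicalSpace Z) (_ : PolishSpace Z) (_ : MeasurableSpace Z)
      (_ : BorelSpace Z) (S : X → Z),
      Measurable S ∧ ∀ x₁ x₂ : X, F x₁ x₂ ↔ S x₁ = S x₂

/-- `f : X → Y` is a uniformization of `P ⊆ X × Y`. -/
def IsUniformization {X Y : Type*} (P : Set (X × Y)) (f : X → Y) : Prop :=
  ∀ x : X, (x, f x) ∈ P

/-- `f` is a Borel `F`-invariant uniformization of `P`: a Borel uniformization of `P` which is a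
homomorphism from `F` to equality on `Y`. -/
def IsBorelInvariantUniformization {X Y : Type*} [MeasurableSpace X] [MeasurableSpace Y]
    (F : Setoid X) (P : Set (X × Y)) (f : X → Y) : Prop :=
  Measurable f ∧ IsUniformization P f ∧ ∀ x₁ x₂ : X, F x₁ x₂ → f x₁ = f x₂

open Set MeasureTheory Topology

/-! The Lusin–Novikov theorem covers `P` by Borel graphs `f n`. The set of `x` where `f n x` misses
some section over the class of `x` is analytic, and by hypothesis these sets have empty
intersection; Novikov separation encloses them in Borel sets `B n` with empty intersection. Off `B
n`, the pairs `(S x, f n x)` form an analytic set with countable sections, so Lusin–Novikov, in its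
form for analytic sets, covers them by graphs over `Z`. A second use of Novikov's theorem picks a
good graph in a Borel way on `Z`; composing with `S` gives invariance.

Lusin–Novikov is proved by contradiction: if no countable family of Borel graphs suffices, a
splitting construction yields a sequence in one fibre whose closure contradicts the Baire category
theorem. -/

/-- A set of sequences is determined by finitely many values near each of its interior points. -/
theorem exists_cylinder_subset_of_isOpen {O : Set (ℕ → ℕ)} (hO : IsOpen O) {x : ℕ → ℕ}
    (hx : x ∈ O) : ∃ m, ∀ y : ℕ → ℕ, (∀ j < m, y j = x j) → y ∈ O := by
  obtain ⟨_, ⟨y, m, rfl⟩, hxy, hsub⟩ :=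
    (PiNat.isTopologicalBasis_cylinders (fun _ : ℕ => ℕ)).exists_subset_of_mem_open hx hO
  refine ⟨m, fun v hv => hsub fun j hj => ?_⟩
  rw [hv j hj, hxy j hj]

/-! ### Novikov separation -/

/-- A family of sets is Borel separable if its members have Borel supersets with empty common
intersection. -/
def BorelSeparable {α : Type*} [MeasurableSpace α] (A : ℕ → Set α) : Prop :=
  ∃ B : ℕ → Set α, (∀ n, MeasurableSet (B n)) ∧ (∀ n, A n ⊆ B n) ∧ ⋂ n, B n = ∅

theorem BorelSeparable.of_iUnion {α : Type*} [MeasurableSpace α] {A : ℕ → Set α}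
    {A' : ℕ → ℕ → Set α} (i : ℕ) (hi : A i ⊆ ⋃ c, A' c i) (hne : ∀ c, ∀ l ≠ i, A l ⊆ A' c l)
    (h : ∀ c, BorelSeparable (A' c)) : BorelSeparable A := by
  choose B hBm hB hBe using h
  refine ⟨fun l => if l = i then ⋃ c, B c i else ⋂ c, B c l, fun l => ?_, fun l => ?_, ?_⟩
  · dsimp only
    split_ifs
    · exact .iUnion fun c => hBm c i
    · exact .iInter fun c => hBm c l
  · dsimp only
    split_ifs with hl
    · subst hl
      exact hi.trans (iUnion_mono fun c => hB c l)
    · exact subset_iInter fun c => (hne c l hl).trans (hB c l)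
  · rw [eq_empty_iff_forall_notMem]
    intro x hx
    rw [mem_iInter] at hx
    have h1 := hx i
    simp only [if_true, mem_iUnion] at h1
    obtain ⟨c, hc⟩ := h1
    have : x ∈ ⋂ n, B c n := by
      refine mem_iInter.2 fun l => ?_
      by_cases hl : l = i
      · exact hl ▸ hc
      · have h2 := hx l
        simp only [hl, if_false, mem_iInter] at h2
        exact h2 c
    rw [hBe c] at this
    exact this

/-- **Novikov's separation theorem**: countably many analytic sets with empty intersection have
Borel supersets with empty intersection. -/
theorem borelSeparable_of_analyticSet {α : Type*} [TopologicalSpace α] [T2Space α]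
    [MeasurableSpace α] [BorelSpace α] {A : ℕ → Set α} (hA : ∀ n, AnalyticSet (A n))
    (hempty : ⋂ n, A n = ∅) : BorelSeparable A := by
  by_cases hne : ∃ n, A n = ∅
  · obtain ⟨n, hn⟩ := hne
    refine ⟨fun l => if l = n then ∅ else univ, fun l => ?_, fun l => ?_, ?_⟩
    · dsimp only
      split_ifs <;> simp
    · dsimp only
      split_ifs with h
      · rw [h, hn]
      · exact subset_univ _
    · exact subset_empty_iff.1 ((iInter_subset _ n).trans (by simp))
  have hA' : ∀ n, ∃ f : (ℕ → ℕ) → α, Continuous f ∧ range f = A n := by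
    intro n
    have h := hA n
    rw [AnalyticSet] at h
    exact h.resolve_left fun h => hne ⟨n, h⟩
  choose f hf hfA using hA'
  by_contra hbad
  -- One sequence `a` codes countably many: entry `Nat.pair i j` is the `j`-th value of the `i`-th.
  -- Fixing one more entry of `a` refines a single cylinder, which is the situation of
  -- `BorelSeparable.of_iUnion`.
  let D : ℕ → (ℕ → ℕ) → ℕ → Set (ℕ → ℕ) := fun k a i =>
    {v | ∀ j, Nat.pair i j < k → v j = a (Nat.pair i j)}
  let Bad : ℕ → (ℕ → ℕ) → Prop := fun k a => ¬ BorelSeparable fun i => f i '' D k a i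
  have hDcongr : ∀ k a a', (∀ l < k, a l = a' l) → D k a = D k a' := by
    intro k a a' h
    funext i
    ext v
    exact forall₂_congr fun j hj => by rw [h _ hj]
  have step : ∀ k a, Bad k a → ∃ c, Bad (k + 1) (Function.update a k c) := by
    intro k a hk
    by_contra! hcon
    refine hk (BorelSeparable.of_iUnion (Nat.unpair k).1
      (A' := fun c i => f i '' D (k + 1) (Function.update a k c) i) ?_ ?_
      fun c => not_not.1 (hcon c))
    · rintro _ ⟨v, hv, rfl⟩
      refine mem_iUnion.2 ⟨v (Nat.unpair k).2, v, fun j hj => ?_, rfl⟩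
      rcases (Nat.lt_succ_iff.1 hj).lt_or_eq with h | h
      · rw [Function.update_of_ne h.ne, hv j h]
      · rw [h, Function.update_self, ← h, Nat.unpair_pair]
    · rintro c l hl _ ⟨v, hv, rfl⟩
      refine ⟨v, fun j hj => ?_, rfl⟩
      rcases (Nat.lt_succ_iff.1 hj).lt_or_eq with h | h
      · rw [Function.update_of_ne h.ne, hv j h]
      · exact absurd (by rw [← h, Nat.unpair_pair]) hl
  choose c hc using step
  have h0 : Bad 0 0 := by
    intro h
    refine hbad ?_
    have : (fun i => f i '' D 0 0 i) = A := by
      funext i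
      have : D 0 0 i = univ := eq_univ_of_forall fun v j hj => absurd hj (Nat.not_lt_zero _)
      rw [this, image_univ, hfA]
    rwa [this] at h
  let s : ∀ k, {a // Bad k a} := fun k =>
    Nat.rec ⟨0, h0⟩ (fun k a => ⟨Function.update a.1 k (c k a.1 a.2), hc k a.1 a.2⟩) k
  have hs : ∀ k l, l ≠ k → (s (k + 1)).1 l = (s k).1 l := fun k l h =>
    Function.update_of_ne h _ _
  let a : ℕ → ℕ := fun l => (s (l + 1)).1 l
  have hsa : ∀ k, ∀ l < k, (s k).1 l = a l := by
    intro k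
    induction k with
    | zero => exact fun l hl => absurd hl (Nat.not_lt_zero _)
    | succ k ih =>
      intro l hl
      rcases (Nat.lt_succ_iff.1 hl).lt_or_eq with h | h
      · rw [hs k l h.ne, ih l h]
      · rw [h]
  have hBad : ∀ k, Bad k a := fun k => by
    have := (s k).2
    simp only [Bad] at this ⊢
    rwa [hDcongr k _ _ (hsa k)] at this
  let w : ℕ → ℕ → ℕ := fun i j => a (Nat.pair i j)
  have hsmall : ∀ i (U : Set α), IsOpen U → f i (w i) ∈ U → ∃ K, ∀ k ≥ K, f i '' D k a i ⊆ U := by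
    intro i U hU hi
    obtain ⟨m, hm⟩ := exists_cylinder_subset_of_isOpen (hU.preimage (hf i)) hi
    refine ⟨Nat.pair i m, fun k hk => ?_⟩
    rintro _ ⟨v, hv, rfl⟩
    exact hm v fun j hj => hv j ((Nat.pair_lt_pair_right i hj).trans_le hk)
  -- Equal limit points would lie in every `A n`; distinct ones have disjoint open neighbourhoods,
  -- which separate a late stage.
  by_cases heq : ∀ i, f i (w i) = f 0 (w 0)
  · have : f 0 (w 0) ∈ ⋂ n, A n := mem_iInter.2 fun i => by
      rw [← heq i, ← hfA i]
      exact mem_range_self _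
    rw [hempty] at this
    exact this
  · push Not at heq
    obtain ⟨i, hi⟩ := heq
    have hi0 : i ≠ 0 := by
      rintro rfl
      exact hi rfl
    obtain ⟨U, V, hU, hV, hiU, h0V, hUV⟩ := t2_separation hi
    obtain ⟨K, hK⟩ := hsmall i U hU hiU
    obtain ⟨L, hL⟩ := hsmall 0 V hV h0V
    refine hBad (max K L) ⟨fun l => if l = i then U else if l = 0 then V else univ,
      fun l => ?_, fun l => ?_, ?_⟩
    · dsimp only
      split_ifs
      exacts [hU.measurableSet, hV.measurableSet, .univ]
    · dsimp only
      split_ifs with h h'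
      · exact h ▸ hK _ (le_max_left _ _)
      · exact h' ▸ hL _ (le_max_right _ _)
      · exact subset_univ _
    · rw [eq_empty_iff_forall_notMem]
      intro x hx
      rw [mem_iInter] at hx
      have h1 := hx i
      have h2 := hx 0
      simp only [if_true, hi0.symm, if_false] at h1 h2
      exact disjoint_left.1 hUV h1 h2

/-! ### Lusin–Novikov covering by Borel graphs -/

section BorelGraphs

variable {Z : Type*} [TopologicalSpace Z] [PolishSpace Z] [MeasurableSpace Z] [BorelSpace Z]
  {Y : Type*} [TopologicalSpace Y] [PolishSpace Y] [MeasurableSpace Y] [BorelSpace Y]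

/-- If `q` factors through `p` on a Borel set, then it factors through a Borel function. -/
theorem exists_measurable_factor [Nonempty Y] {W : Type*} [TopologicalSpace W] [PolishSpace W]
    [MeasurableSpace W] [BorelSpace W] {p : W → Z} {q : W → Y} (hp : Measurable p)
    (hq : Measurable q) {E : Set W} (hE : MeasurableSet E)
    (hfun : ∀ w ∈ E, ∀ w' ∈ E, p w = p w' → q w = q w') :
    ∃ g : Z → Y, Measurable g ∧ ∀ w ∈ E, q w = g (p w) := by
  obtain ⟨e, he, hinj⟩ := MeasurableSpace.measurable_injection_nat_bool_of_countablySeparated Y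
  have hemb : MeasurableEmbedding e := he.measurableEmbedding hinj
  have hm : ∀ (i : ℕ) (b : Bool), MeasurableSet (E ∩ {w | e (q w) i = b}) := fun i b =>
    hE.inter ((measurable_pi_apply i).comp (he.comp hq) (measurableSet_singleton b))
  -- Each bit of `q` is a function of `p` on `E`, so the two images are disjoint analytic sets.
  have hsep : ∀ i, MeasurablySeparable (p '' (E ∩ {w | e (q w) i = true}))
      (p '' (E ∩ {w | e (q w) i = false})) := by
    refine fun i => ((hm i true).analyticSet_image hp).measurablySeparable
      ((hm i false).analyticSet_image hp) (disjoint_left.2 ?_)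
    rintro _ ⟨w, ⟨hw, hwi⟩, rfl⟩ ⟨w', ⟨hw', hwi'⟩, hpp⟩
    have := hfun w' hw' w hw hpp
    simp only [mem_ofPred_eq] at hwi hwi'
    rw [this, hwi] at hwi'
    exact Bool.noConfusion hwi'
  choose B hB1 hB2 hBm using hsep
  classical
  let h : Z → ℕ → Bool := fun z i => decide (z ∈ B i)
  have hh : Measurable h := measurable_pi_lambda _ fun i => by
    refine measurable_to_bool ?_
    convert hBm i
    ext z
    simp [h]
  obtain ⟨g, hg, hge⟩ := hemb.exists_measurable_extend measurable_id fun _ => ‹Nonempty Y›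
  refine ⟨g ∘ h, hg.comp hh, fun w hw => ?_⟩
  have : h (p w) = e (q w) := by
    funext i
    cases hi : e (q w) i with
    | true => exact decide_eq_true (hB1 i ⟨w, ⟨hw, hi⟩, rfl⟩)
    | false => exact decide_eq_false (disjoint_left.1 (hB2 i) ⟨w, ⟨hw, hi⟩, rfl⟩)
  rw [Function.comp_apply, this]
  exact (congrFun hge (q w)).symm

/-- A set of sequences `w`, thought of as tuples `(w 0, …, w k)` in a fibre of `p`, is coverable
if for countably many Borel functions `g n` each tuple has an entry with `q (w i) = g n (p (w 0))`
for some `n`. -/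
def Coverable (p : (ℕ → ℕ) → Z) (q : (ℕ → ℕ) → Y) (k : ℕ) (A : Set (ℕ → ℕ → ℕ)) : Prop :=
  ∃ g : ℕ → Z → Y, (∀ n, Measurable (g n)) ∧ ∀ w ∈ A, ∃ i ≤ k, ∃ n, q (w i) = g n (p (w 0))

/-- Tuples in a common fibre of `p` whose entries agree with those of `u` up to `m`. -/
def fibreBox (p : (ℕ → ℕ) → Z) (k m : ℕ) (u : ℕ → ℕ → ℕ) : Set (ℕ → ℕ → ℕ) :=
  {w | ∀ i ≤ k, p (w i) = p (w 0) ∧ ∀ j < m, w i j = u i j}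

variable {p : (ℕ → ℕ) → Z} {q : (ℕ → ℕ) → Y}

omit [TopologicalSpace Z] [PolishSpace Z] [BorelSpace Z] [TopologicalSpace Y] [PolishSpace Y]
  [BorelSpace Y] in
theorem Coverable.mono {k : ℕ} {A A' : Set (ℕ → ℕ → ℕ)} (h : Coverable p q k A') (hA : A ⊆ A') :
    Coverable p q k A :=
  let ⟨g, hg, hc⟩ := h
  ⟨g, hg, fun w hw => hc w (hA hw)⟩

omit [TopologicalSpace Z] [PolishSpace Z] [BorelSpace Z] [TopologicalSpace Y] [PolishSpace Y]
  [BorelSpace Y] in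
-- Countably many countable covers merge into one.
theorem exists_not_coverable_fibre {ι : Type*} [Countable ι] [Nonempty ι] {k : ℕ}
    {A : Set (ℕ → ℕ → ℕ)} (h : ¬ Coverable p q k A) (π : (ℕ → ℕ → ℕ) → ι) :
    ∃ t, ¬ Coverable p q k (A ∩ π ⁻¹' {t}) := by
  by_contra! hcon
  choose g hg hc using hcon
  obtain ⟨s, hs⟩ := exists_surjective_nat (ι × ℕ)
  refine h ⟨fun n => g (s n).1 (s n).2, fun n => hg _ _, fun w hw => ?_⟩
  obtain ⟨i, hi, n, hn⟩ := hc (π w) w ⟨hw, rfl⟩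
  obtain ⟨n', hn'⟩ := hs (π w, n)
  exact ⟨i, hi, n', by simp only [hn', hn]⟩

omit [TopologicalSpace Z] [PolishSpace Z] [BorelSpace Z] [TopologicalSpace Y] [PolishSpace Y]
  [BorelSpace Y] in
theorem nonempty_of_not_coverable [Nonempty Y] {k : ℕ} {A : Set (ℕ → ℕ → ℕ)}
    (h : ¬ Coverable p q k A) : A.Nonempty := by
  by_contra hA
  rw [not_nonempty_iff_eq_empty] at hA
  exact h ⟨fun _ _ => Classical.arbitrary Y, fun _ => measurable_const, by simp [hA]⟩

/-- An uncoverable box stays uncoverable when a new entry is added next to the `i`-th one, with a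
different value of `q`. -/
theorem not_coverable_split [Nonempty Y] (hp : Continuous p) (hq : Continuous q) {k m i : ℕ}
    {u : ℕ → ℕ → ℕ} (hi : i ≤ k) (h : ¬ Coverable p q k (fibreBox p k m u)) :
    ¬ Coverable p q (k + 1) {w | w ∈ fibreBox p k m u ∧ p (w (k + 1)) = p (w 0) ∧
      (∀ j < m, w (k + 1) j = u i j) ∧ q (w (k + 1)) ≠ q (w i)} := by
  rintro ⟨g, hg, hc⟩
  let E : Set (ℕ → ℕ → ℕ) := fibreBox p k m u ∩ {w | ∀ l ≤ k, ∀ n, q (w l) ≠ g n (p (w 0))}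
  have hpl : ∀ l, Measurable fun w : ℕ → ℕ → ℕ => p (w l) := fun l =>
    hp.measurable.comp (measurable_pi_apply l)
  have hql : ∀ l, Measurable fun w : ℕ → ℕ → ℕ => q (w l) := fun l =>
    hq.measurable.comp (measurable_pi_apply l)
  have hE : MeasurableSet E := by
    have h1 : MeasurableSet (fibreBox p k m u) := by
      have : fibreBox p k m u = ⋂ l, ⋂ (_ : l ≤ k), ({w | p (w l) = p (w 0)} ∩
          ⋂ j, ⋂ (_ : j < m), {w | w l j = u l j}) := by
        ext w
        simp [fibreBox]
      rw [this]
      exact .iInter fun l => .iInter fun _ => (measurableSet_eq_fun (hpl l) (hpl 0)).inter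
        (.iInter fun j => .iInter fun _ => measurableSet_eq_fun
          ((measurable_pi_apply j).comp (measurable_pi_apply l)) measurable_const)
    refine h1.inter ?_
    have : {w : ℕ → ℕ → ℕ | ∀ l ≤ k, ∀ n, q (w l) ≠ g n (p (w 0))} =
        ⋂ l, ⋂ (_ : l ≤ k), ⋂ n, {w | q (w l) = g n (p (w 0))}ᶜ := by
      ext w
      simp
    rw [this]
    exact .iInter fun l => .iInter fun _ => .iInter fun n =>
      (measurableSet_eq_fun (hql l) ((hg n).comp (hpl 0))).compl
  -- If `w` and `v` in `E` share a fibre but differ in `q` at entry `i`, appending `v i` to `w`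
  -- gives a split tuple that no `g n` covers. Hence one further function `g'` covers `E`.
  obtain ⟨g', hg', hgE⟩ := exists_measurable_factor (hpl 0) (hql i) hE (by
    rintro w ⟨hw, hwg⟩ v ⟨hv, hvg⟩ hwv
    by_contra hne
    have hlt : ∀ l ≤ k, Function.update w (k + 1) (v i) l = w l := fun l hl =>
      Function.update_of_ne (by lia) _ _
    obtain ⟨l, hl, n, hn⟩ := hc (Function.update w (k + 1) (v i)) (by
      refine ⟨fun l hl => ?_, ?_, ?_, ?_⟩
      · rw [hlt l hl, hlt 0 (Nat.zero_le _)]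
        exact hw l hl
      · rw [Function.update_self, hlt 0 (Nat.zero_le _), hwv]
        exact (hv i hi).1
      · rw [Function.update_self]
        exact (hv i hi).2
      · rw [Function.update_self, hlt i hi]
        exact Ne.symm hne)
    rw [hlt 0 (Nat.zero_le _)] at hn
    rcases Nat.le_or_eq_of_le_succ hl with hl | rfl
    · rw [hlt l hl] at hn
      exact hwg l hl n hn
    · rw [Function.update_self, hwv] at hn
      exact hvg i hi n hn)
  refine h ⟨fun n => Nat.casesOn n g' g, fun n => ?_, fun w hw => ?_⟩
  · cases n
    exacts [hg', hg _]
  · by_cases hwE : w ∈ E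
    · exact ⟨i, hi, 0, hgE w hwE⟩
    · have : ∃ l ≤ k, ∃ n, q (w l) = g n (p (w 0)) := by
        by_contra! hcon
        exact hwE ⟨hw, hcon⟩
      obtain ⟨l, hl, n, hn⟩ := this
      exact ⟨l, hl, n + 1, hn⟩

theorem exists_not_coverable_extension [Nonempty Y] (hp : Continuous p) (hq : Continuous q)
    {k m i : ℕ} {u : ℕ → ℕ → ℕ} (hi : i ≤ k) (h : ¬ Coverable p q k (fibreBox p k m u)) :
    ∃ (m' : ℕ) (u' : ℕ → ℕ → ℕ), m < m' ∧ (∀ l ≤ k, ∀ j < m, u' l j = u l j) ∧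
      (∀ j < m, u' (k + 1) j = u i j) ∧ (∀ l ≤ k + 1, p (u' l) = p (u' 0)) ∧
      (∀ v v' : ℕ → ℕ, (∀ j < m', v j = u' i j) → (∀ j < m', v' j = u' (k + 1) j) →
        q v' ≠ q v) ∧
      ¬ Coverable p q (k + 1) (fibreBox p (k + 1) m' u') := by
  have hbad := not_coverable_split hp hq hi h
  have hsep : ∀ w : ℕ → ℕ → ℕ, ∃ M, q (w (k + 1)) ≠ q (w i) →
      ∀ v v' : ℕ → ℕ, (∀ j < M, v j = w i j) → (∀ j < M, v' j = w (k + 1) j) → q v' ≠ q v := by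
    intro w
    by_cases hw : q (w (k + 1)) = q (w i)
    · exact ⟨0, fun h => absurd hw h⟩
    obtain ⟨U, V, hU, hV, hwU, hwV, hUV⟩ := t2_separation hw
    obtain ⟨a, ha⟩ := exists_cylinder_subset_of_isOpen (hU.preimage hq) hwU
    obtain ⟨b, hb⟩ := exists_cylinder_subset_of_isOpen (hV.preimage hq) hwV
    refine ⟨max a b, fun _ v v' hv hv' heq => ?_⟩
    have h1 : q v' ∈ U := ha v' fun j hj => hv' j (hj.trans_le (le_max_left _ _))
    have h2 : q v ∈ V := hb v fun j hj => hv j (hj.trans_le (le_max_right _ _))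
    exact disjoint_left.1 hUV h1 (heq ▸ h2)
  choose M hM using hsep
  -- There are only countably many separating lengths and initial segments, so some choice stays
  -- uncoverable. The `m + 1` makes the length grow strictly.
  let π : (ℕ → ℕ → ℕ) → (Σ M : ℕ, Fin (k + 2) → Fin M → ℕ) := fun w =>
    ⟨max (M w) (m + 1), fun l j => w l j⟩
  obtain ⟨t, ht⟩ := exists_not_coverable_fibre hbad π
  obtain ⟨u', ⟨hu'box, hu'p, hu'm, hu'q⟩, rfl⟩ := nonempty_of_not_coverable ht
  refine ⟨max (M u') (m + 1), u', by lia, fun l hl => (hu'box l hl).2, hu'm, fun l hl => ?_,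
    fun v v' hv hv' => hM u' hu'q v v' (fun j hj => hv j (by lia)) fun j hj => hv' j (by lia),
    fun hcov => ht (hcov.mono ?_)⟩
  · rcases Nat.le_or_eq_of_le_succ hl with hl | rfl
    exacts [(hu'box l hl).1, hu'p]
  · rintro w ⟨⟨hwbox, hwp, -, -⟩, hwπ⟩ l hl
    refine ⟨?_, fun j hj => ?_⟩
    · rcases Nat.le_or_eq_of_le_succ hl with hl | rfl
      exacts [(hwbox l hl).1, hwp]
    · have key : ∀ s : Σ M : ℕ, Fin (k + 2) → Fin M → ℕ, s = π u' →
          ∀ (l : Fin (k + 2)) (j : ℕ) (hj : j < s.1), s.2 l ⟨j, hj⟩ = u' l j := by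
        rintro _ rfl l j hj
        rfl
      have hw1 : (π w).1 = (π u').1 := congrArg Sigma.fst hwπ
      exact key (π w) hwπ ⟨l, by lia⟩ j (by rw [hw1]; exact hj)

/-- Either the image of `(p, q)` is covered by countably many Borel graphs, or there are points in
one fibre of `p` each of which is a limit of others with a different value of `q`. -/
theorem exists_measurable_cover_or_exists_seq [Nonempty Y] (hp : Continuous p)
    (hq : Continuous q) :
    (∃ g : ℕ → Z → Y, (∀ n, Measurable (g n)) ∧ ∀ v, ∃ n, q v = g n (p v)) ∨
    ∃ w : ℕ → ℕ → ℕ, (∀ i, p (w i) = p (w 0)) ∧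
      ∀ i M, ∃ i', (∀ j < M, w i' j = w i j) ∧ q (w i') ≠ q (w i) := by
  by_cases h0 : Coverable p q 0 (fibreBox p 0 0 0)
  · obtain ⟨g, hg, hc⟩ := h0
    refine .inl ⟨g, hg, fun v => ?_⟩
    obtain ⟨i, -, n, hn⟩ := hc (fun _ => v) fun i _ => ⟨rfl, fun j hj => absurd hj (by lia)⟩
    exact ⟨n, hn⟩
  right
  -- Stage `k` splits entry `(Nat.unpair k).1`, so every entry is split infinitely often.
  have hstep : ∀ k (s : {s : ℕ × (ℕ → ℕ → ℕ) // ¬ Coverable p q k (fibreBox p k s.1 s.2)}),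
      ∃ s' : {s : ℕ × (ℕ → ℕ → ℕ) // ¬ Coverable p q (k + 1) (fibreBox p (k + 1) s.1 s.2)},
      s.1.1 < s'.1.1 ∧ (∀ l ≤ k, ∀ j < s.1.1, s'.1.2 l j = s.1.2 l j) ∧
      (∀ j < s.1.1, s'.1.2 (k + 1) j = s.1.2 (Nat.unpair k).1 j) ∧
      (∀ l ≤ k + 1, p (s'.1.2 l) = p (s'.1.2 0)) ∧
      (∀ v v' : ℕ → ℕ, (∀ j < s'.1.1, v j = s'.1.2 (Nat.unpair k).1 j) →
        (∀ j < s'.1.1, v' j = s'.1.2 (k + 1) j) → q v' ≠ q v) := by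
    rintro k ⟨⟨m, u⟩, hs⟩
    obtain ⟨m', u', h1, h2, h3, h4, h5, h6⟩ :=
      exists_not_coverable_extension hp hq (Nat.unpair_left_le k) hs
    exact ⟨⟨⟨m', u'⟩, h6⟩, h1, h2, h3, h4, h5⟩
  choose nxt hlt hold hnew hfib hsep using hstep
  let s : ∀ k, {s : ℕ × (ℕ → ℕ → ℕ) // ¬ Coverable p q k (fibreBox p k s.1 s.2)} := fun k =>
    Nat.rec ⟨(0, 0), h0⟩ nxt k
  let m : ℕ → ℕ := fun k => (s k).1.1
  let u : ℕ → ℕ → ℕ → ℕ := fun k => (s k).1.2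
  replace hlt : ∀ k, m k < m (k + 1) := fun k => hlt k (s k)
  replace hold : ∀ k, ∀ l ≤ k, ∀ j < m k, u (k + 1) l j = u k l j := fun k => hold k (s k)
  replace hnew : ∀ k, ∀ j < m k, u (k + 1) (k + 1) j = u k (Nat.unpair k).1 j := fun k =>
    hnew k (s k)
  replace hfib : ∀ k, ∀ l ≤ k + 1, p (u (k + 1) l) = p (u (k + 1) 0) := fun k => hfib k (s k)
  replace hsep : ∀ k, ∀ v v' : ℕ → ℕ, (∀ j < m (k + 1), v j = u (k + 1) (Nat.unpair k).1 j) →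
        (∀ j < m (k + 1), v' j = u (k + 1) (k + 1) j) → q v' ≠ q v := fun k => hsep k (s k)
  have hm : StrictMono m := strictMono_nat_of_lt_succ hlt
  have hcoh : ∀ k k', k ≤ k' → ∀ l ≤ k, ∀ j < m k, u k' l j = u k l j := by
    intro k k' hk
    induction k', hk using Nat.le_induction with
    | base => exact fun _ _ _ _ => rfl
    | succ k' hk ih =>
      intro l hl j hj
      rw [hold k' l (hl.trans hk) j (hj.trans_le (hm.monotone hk)), ih l hl j hj]
  let w : ℕ → ℕ → ℕ := fun i j => u (max i (j + 1)) i j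
  have hw : ∀ k, ∀ i ≤ k, ∀ j < m k, w i j = u k i j := by
    intro k i hi j hj
    have hj' : j < m (max i (j + 1)) :=
      (Nat.lt_succ_self j).trans_le ((le_max_right i (j + 1)).trans (hm.id_le _))
    rcases le_total (max i (j + 1)) k with h | h
    · exact (hcoh _ _ h i (le_max_left _ _) j hj').symm
    · exact hcoh _ _ h i hi j hj
  have htend : ∀ i, Filter.Tendsto (fun k => u (k + 1) i) Filter.atTop (𝓝 (w i)) := by
    intro i
    refine tendsto_pi_nhds.2 fun j => tendsto_const_nhds.congr' ?_
    filter_upwards [Filter.eventually_ge_atTop (max i (j + 1))] with k hk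
    refine hw (k + 1) i (by lia) j ?_
    have := hm.id_le (k + 1)
    simp only [id] at this
    lia
  refine ⟨w, fun i => ?_, fun i M => ?_⟩
  · refine tendsto_nhds_unique ((hp.tendsto _).comp (htend i))
      (((hp.tendsto _).comp (htend 0)).congr' ?_)
    filter_upwards [Filter.eventually_ge_atTop i] with k hk
    exact (hfib k i (by lia)).symm
  · let k := Nat.pair i M
    have hki : (Nat.unpair k).1 = i := by simp [k]
    have hik : i ≤ k := Nat.left_le_pair i M
    have hMk : M ≤ m k := (Nat.right_le_pair i M).trans (hm.id_le _)
    refine ⟨k + 1, fun j hj => ?_, hsep k (w i) (w (k + 1)) (fun j hj => ?_) fun j hj => ?_⟩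
    · rw [hw (k + 1) (k + 1) le_rfl j (by have := hlt k; lia), hnew k j (by lia), hki,
        hw k i hik j (by lia)]
    · rw [hki]
      exact hw (k + 1) i (by lia) j hj
    · exact hw (k + 1) (k + 1) le_rfl j hj

/-- Otherwise the closure of the sequence lies in one fibre, where `q` takes countably many values.
By Baire, `q` is constant on a nonempty relatively open subset; it contains some `w i` and also a
nearby `w i'` with another value. -/
theorem exists_measurable_cover_of_continuous [Nonempty Y] (hp : Continuous p)
    (hq : Continuous q) (hcount : ∀ z, (q '' (p ⁻¹' {z})).Countable) :
    ∃ g : ℕ → Z → Y, (∀ n, Measurable (g n)) ∧ ∀ v, ∃ n, q v = g n (p v) := by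
  refine (exists_measurable_cover_or_exists_seq hp hq).resolve_right ?_
  rintro ⟨w, hwp, hw⟩
  let K : Set (ℕ → ℕ) := closure (range w)
  have hKp : ∀ v ∈ K, p v = p (w 0) :=
    closure_minimal (range_subset_iff.2 hwp) (isClosed_eq hp continuous_const)
  have hwK : ∀ i, w i ∈ K := fun i => subset_closure (mem_range_self i)
  have : PolishSpace K := isClosed_closure.polishSpace
  have : Nonempty K := ⟨⟨w 0, hwK 0⟩⟩
  let R : Set Y := q '' (p ⁻¹' {p (w 0)})
  have : Countable R := (hcount (p (w 0))).to_subtype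
  obtain ⟨y, ⟨x, hx⟩⟩ := nonempty_interior_of_iUnion_of_closed
    (f := fun y : R => {v : K | q v = y})
    (fun y => isClosed_eq (hq.comp continuous_subtype_val) continuous_const)
    (eq_univ_of_forall fun v => mem_iUnion.2 ⟨⟨q v, v, hKp v v.2, rfl⟩, rfl⟩)
  obtain ⟨O, hO, hOeq⟩ := isOpen_induced_iff.1 (isOpen_interior (s := {v : K | q v = y}))
  have hOy : ∀ v ∈ K, v ∈ O → q v = y := fun v hv hvO => by
    have : (⟨v, hv⟩ : K) ∈ Subtype.val ⁻¹' O := hvO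
    rw [hOeq] at this
    exact (interior_subset : _ ⊆ {v : K | q v = y}) this
  rw [← hOeq] at hx
  obtain ⟨_, hiO, ⟨i, rfl⟩⟩ := mem_closure_iff.1 x.2 O hO hx
  obtain ⟨M, hM⟩ := exists_cylinder_subset_of_isOpen hO hiO
  obtain ⟨i', hi', hne⟩ := hw i M
  exact hne ((hOy _ (hwK i') (hM _ hi')).trans (hOy _ (hwK i) hiO).symm)

/-- An analytic set with countable sections is covered by countably many graphs of Borel
functions. -/
theorem MeasureTheory.AnalyticSet.exists_measurable_cover [Nonempty Y] {R : Set (Z × Y)}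
    (hR : AnalyticSet R) (hcount : ∀ z, (xSection R z).Countable) :
    ∃ g : ℕ → Z → Y, (∀ n, Measurable (g n)) ∧ ∀ z y, (z, y) ∈ R → ∃ n, y = g n z := by
  rw [AnalyticSet] at hR
  rcases hR with rfl | ⟨f, hf, rfl⟩
  · exact ⟨fun _ _ => Classical.arbitrary Y, fun _ => measurable_const, fun _ _ h => h.elim⟩
  obtain ⟨g, hg, hc⟩ := exists_measurable_cover_of_continuous (p := fun v => (f v).1)
    (q := fun v => (f v).2) (continuous_fst.comp hf) (continuous_snd.comp hf) (fun z =>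
      (hcount z).mono (by
        rintro _ ⟨v, rfl, rfl⟩
        exact mem_range_self v))
  refine ⟨g, hg, ?_⟩
  rintro z y ⟨v, hv⟩
  simpa [hv] using hc v

end BorelGraphs

/-! ### Invariant uniformization -/

theorem exists_measurable_factor_uniformization
    {X : Type*} [TopologicalSpace X] [PolishSpace X] [MeasurableSpace X] [BorelSpace X]
    {Y : Type*} [TopologicalSpace Y] [PolishSpace Y] [MeasurableSpace Y] [BorelSpace Y]
    {Z : Type*} [TopologicalSpace Z] [PolishSpace Z] [MeasurableSpace Z] [BorelSpace Z]
    [Nonempty Y] {S : X → Z} (hS : Measurable S) {P : Set (X × Y)} (hP : MeasurableSet P)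
    (hcount : ∀ x, (xSection P x).Countable)
    (hinter : ∀ x, ∃ y, ∀ x', S x' = S x → (x', y) ∈ P) :
    ∃ f : Z → Y, Measurable f ∧ ∀ x, (x, f (S x)) ∈ P := by
  obtain ⟨f, hf, hfP⟩ := hP.analyticSet.exists_measurable_cover hcount
  let Φ : ℕ → Set X := fun n => {x | ∃ x', S x' = S x ∧ (x', f n x) ∉ P}
  have hΦ : ∀ n, AnalyticSet (Φ n) := by
    intro n
    have : Φ n = Prod.fst '' ({r : X × X | S r.2 = S r.1} ∩ {r | (r.2, f n r.1) ∈ P}ᶜ) := by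
      ext x
      simp [Φ]
    rw [this]
    exact ((measurableSet_eq_fun (hS.comp measurable_snd) (hS.comp measurable_fst)).inter
      ((measurable_snd.prodMk ((hf n).comp measurable_fst)) hP).compl).analyticSet_image
      measurable_fst
  obtain ⟨B, hBm, hB, hBe⟩ := borelSeparable_of_analyticSet hΦ (by
    rw [eq_empty_iff_forall_notMem]
    intro x hx
    obtain ⟨y, hy⟩ := hinter x
    obtain ⟨n, rfl⟩ := hfP x y (hy x rfl)
    obtain ⟨x', hx', hx'P⟩ := mem_iInter.1 hx n
    exact hx'P (hy x' hx'))
  have hBP : ∀ n, ∀ x ∉ B n, ∀ x', S x' = S x → (x', f n x) ∈ P := fun n x hx x' hx' => by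
    by_contra hcon
    exact hx (hB n ⟨x', hx', hcon⟩)
  have hcov : ∀ n, ∃ g : ℕ → Z → Y, (∀ i, Measurable (g i)) ∧
      ∀ x ∉ B n, ∃ i, f n x = g i (S x) := by
    intro n
    -- Over `S x`, this image lies in the countable section of `P` at `x`.
    obtain ⟨g, hg, hgc⟩ := ((hBm n).compl.analyticSet_image
      (hS.prodMk (hf n))).exists_measurable_cover (fun z => by
        by_cases hz : ∃ x, S x = z
        · obtain ⟨x, rfl⟩ := hz
          refine (hcount x).mono ?_
          rintro y ⟨x', hx', heq⟩
          obtain ⟨h1, rfl⟩ := Prod.mk.inj heq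
          exact hBP n x' hx' x h1.symm
        · convert countable_empty
          rw [eq_empty_iff_forall_notMem]
          rintro y ⟨x', -, heq⟩
          exact hz ⟨x', (Prod.mk.inj heq).1⟩)
    exact ⟨g, hg, fun x hx => hgc _ _ ⟨x, hx, rfl⟩⟩
  choose g hg hgc using hcov
  let G : ℕ → Z → Y := fun k => g (Nat.unpair k).1 (Nat.unpair k).2
  have hG : ∀ k, Measurable (G k) := fun k => hg _ _
  obtain ⟨C, hCm, hC, hCe⟩ := borelSeparable_of_analyticSet
    (A := fun k => S '' {x | (x, G k (S x)) ∈ P}ᶜ)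
    (fun k => ((measurable_id.prodMk ((hG k).comp hS)) hP).compl.analyticSet_image hS) (by
      rw [eq_empty_iff_forall_notMem]
      intro z hz
      rw [mem_iInter] at hz
      obtain ⟨x, -, rfl⟩ := hz 0
      obtain ⟨n, hn⟩ : ∃ n, x ∉ B n := by
        by_contra! hcon
        have : x ∈ ⋂ n, B n := mem_iInter.2 hcon
        rw [hBe] at this
        exact this
      obtain ⟨i, hi⟩ := hgc n x hn
      obtain ⟨x', hx', hxx'⟩ := hz (Nat.pair n i)
      refine hx' ?_
      have : G (Nat.pair n i) (S x') = f n x := by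
        simp [G, hxx', hi]
      simp only [mem_ofPred_eq, this]
      exact hBP n x hn x' hxx')
  have hex : ∀ z, ∃ k, z ∉ C k := fun z => by
    by_contra! hcon
    have : z ∈ ⋂ n, C n := mem_iInter.2 hcon
    rw [hCe] at this
    exact this
  classical
  -- The least `k` with `z ∉ C k` depends on `z` in a Borel way.
  refine ⟨fun z => G (Nat.find (hex z)) z, Measurable.find hG (fun k => (hCm k).compl) hex,
    fun x => ?_⟩
  by_contra hcon
  exact Nat.find_spec (hex (S x)) (hC _ ⟨x, hcon, rfl⟩)

theorem mainTheorem4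
    {X : Type u} [TopologicalSpace X] [PolishSpace X] [MeasurableSpace X] [BorelSpace X]
    {Y : Type v} [TopologicalSpace Y] [PolishSpace Y] [MeasurableSpace Y] [BorelSpace Y]
    (F : Setoid X) (hF : IsSmoothBorelEquivRel.{u, w} F)
    (P : Set (X × Y)) (hP : MeasurableSet P)
    (hcount : ∀ x : X, (xSection P x).Countable)
    (hinter : ∀ C ∈ F.classes, (⋂ x ∈ C, xSection P x).Nonempty) :
    ∃ f : X → Y, IsBorelInvariantUniformization F P f := by
  obtain ⟨-, Z, _, _, _, _, S, hS, hFS⟩ := hF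
  have hne : ∀ x, ∃ y, ∀ x', S x' = S x → (x', y) ∈ P := by
    intro x
    obtain ⟨y, hy⟩ := hinter _ (Setoid.mem_classes F x)
    exact ⟨y, fun x' hx' => mem_iInter₂.1 hy x' ((hFS x' x).2 hx')⟩
  cases isEmpty_or_nonempty X with
  | inl _ =>
    exact ⟨isEmptyElim, measurable_of_empty _, fun x => isEmptyElim x, fun x => isEmptyElim x⟩
  | inr hX =>
    have : Nonempty Y := (hne hX.some).nonempty
    obtain ⟨f, hf, hfP⟩ := exists_measurable_factor_uniformization hS hP hcount hne
    exact ⟨f ∘ S, hf.comp hS, hfP, fun x₁ x₂ h => congrArg f ((hFS x₁ x₂).1 h)⟩
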